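/- Let $n\ge 3$. An $n$-polytope is the convex hull of finitely many points of $\mathbb{R}^n$ that has nonempty interior; its facets are its faces of dimension $n-1$. For an $n$-polytope $C\subset\mathbb{R}^n$, a set $K\subseteq\mathbb{R}^n$ is called $C$-ball convex if $K=\emptyset$, or $K=\mathbb{R}^n$, or $K$ is the intersection of all translates of $C$ that contain $K$. The $C$-ball convex hull of a set $A\subseteq\mathbb{R}^n$ is the intersection of all $C$-ball convex sets containing $A$. For an integer $k\ge 2$ we say that every $C$-ball convex set is $k$-generated if every $C$-ball convex set is the $C$-ball convex hull of a set of at most $k$ points of $\mathbb{R}^n$. (1) If $2\le k\le n$, then there is an $n$-polytope $C\subset\mathbb{R}^n$ having exactly $n+k+2$ facets such that not every $C$-ball convex set is $k$-generated. (2) If $k\ge 2$ and $C\subset\mathbb{R}^n$ is any $n$-polytope having at most $n+k+1$ facets, then every $C$-ball convex set is $k$-generated. -/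

import Mathlib

open scoped Pointwise

namespace BallConvexity

/-- An `n`-polytope in `ℝⁿ`: the convex hull of finitely many points, with nonempty interior
(such a set is automatically compact and convex, hence a convex body). -/
def IsFullPolytope {n : ℕ} (C : Set (EuclideanSpace ℝ (Fin n))) : Prop :=
  (∃ V : Set (EuclideanSpace ℝ (Fin n)), V.Finite ∧ C = convexHull ℝ V) ∧ (interior C).Nonempty

/-- The facets of `C ⊆ ℝⁿ`: the nonempty exposed faces of affine dimension `n - 1`. -/
def facets {n : ℕ} (C : Set (EuclideanSpace ℝ (Fin n))) :
    Set (Set (EuclideanSpace ℝ (Fin n))) :=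
  {F | F.Nonempty ∧ IsExposed ℝ C F ∧ Module.finrank ℝ (vectorSpan ℝ F) + 1 = n}

/-- `K` is `C`-ball convex: `K` is empty, or the whole space, or the intersection of all
translates of `C` that contain `K`. -/
def IsBallConvex {n : ℕ} (C K : Set (EuclideanSpace ℝ (Fin n))) : Prop :=
  K = ∅ ∨ K = Set.univ ∨
    K = ⋂₀ {D | (∃ v : EuclideanSpace ℝ (Fin n), D = v +ᵥ C) ∧ K ⊆ D}

/-- The `C`-ball convex hull of `A`: the intersection of all `C`-ball convex sets containing `A`. -/
def ballHull {n : ℕ} (C A : Set (EuclideanSpace ℝ (Fin n))) : Set (EuclideanSpace ℝ (Fin n)) :=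
  ⋂₀ {K | IsBallConvex C K ∧ A ⊆ K}

/-- Every `C`-ball convex set is `k`-generated: it is the `C`-ball convex hull of at most
`k` points. -/
def EveryBallConvexGenerated {n : ℕ} (C : Set (EuclideanSpace ℝ (Fin n))) (k : ℕ) : Prop :=
  ∀ K : Set (EuclideanSpace ℝ (Fin n)), IsBallConvex C K →
    ∃ T : Finset (EuclideanSpace ℝ (Fin n)), T.card ≤ k ∧ K = ballHull C (T : Set _)

end BallConvexity

/-! Write `C` as `{f i ≤ h i}` with one inequality per facet. A nonempty bounded `C`-ball convex `K`
is cut out by the same functionals, with their maxima over `K` as bounds, and a set `T ⊆ K` has hull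
`K` as soon as it touches every inequality. Part (2) thus asks for `k` points of `K` touching at
most `n + k + 1` attained inequalities.

A vertex `x` of `K` touches at least `n` of them, so at most `k + 1` remain. Divide each remaining
functional by its slack at `x`: the inequalities first met by a ray from `x` are those whose
normalized functional is maximal in its direction. Join two inequalities if some feasible direction
meets both first; no vertex of this graph is isolated (`exists_adjacent`). If at most `k`
inequalities remain, `x` and the endpoint of one edge save enough points. Otherwise two disjoint
edges suffice together with `x`. With no disjoint edges the graph is a triangle or a star. A
triangle has a common maximizing direction (`exists_dominates_three`). For a star, `x` is a simple
vertex and is discarded: two points obtained in directions with disjoint supports among the edge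
directions touch the centre, two leaves and all inequalities tight at `x`
(`exists_disjoint_support_of_leaves`). This is where `n ≥ 3` enters.

For part (1), truncate a simplex at `k + 1` vertices to get `P`, and take `C = 2P`. Then `P` is
`C`-ball convex, any generating set must touch all its facets, and the `k + 1` cuts are pairwise
disjoint. -/

namespace BallConvexity

/-! ### Regions of a salient cone where one of finitely many functionals is maximal. -/

section Dominance

variable {E ρ : Type*} [AddCommGroup E] [Module ℝ E]

/-- The nonzero vector `v` of the cone `V` is dominated by `a`: among the functionals `ℓ b`,
the functional `ℓ a` is maximal at `v`. -/
def Dominates (V : ConvexCone ℝ E) (ℓ : ρ → E →ₗ[ℝ] ℝ) (a : ρ) (v : E) : Prop :=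
  v ∈ V ∧ v ≠ 0 ∧ ∀ b, ℓ b v ≤ ℓ a v

/-- Two functionals are adjacent if they are simultaneously maximal at some vector of the cone. -/
def Adjacent (V : ConvexCone ℝ E) (ℓ : ρ → E →ₗ[ℝ] ℝ) (a b : ρ) : Prop :=
  ∃ v, Dominates V ℓ a v ∧ Dominates V ℓ b v

variable {V : ConvexCone ℝ E} {ℓ : ρ → E →ₗ[ℝ] ℝ} {a b c : ρ}

theorem Adjacent.symm (h : Adjacent V ℓ a b) : Adjacent V ℓ b a :=
  let ⟨v, h₁, h₂⟩ := h; ⟨v, h₂, h₁⟩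

theorem add_ne_zero_of_salient (hV : V.Salient) {p q : E} (hp : p ∈ V) (hp0 : p ≠ 0)
    (hq : q ∈ V) : p + q ≠ 0 := fun h =>
  hV p hp hp0 (by rwa [neg_eq_of_add_eq_zero_right h])

/-- The first point where a ray of the form `p + θ q` leaves the region dominated by `a`. -/
theorem exists_crossing [Finite ρ] (hV : V.Salient) {p q : E} (hp : Dominates V ℓ a p)
    (hq : q ∈ V) (hq0 : q ≠ 0) (hqa : ¬ Dominates V ℓ a q) :
    ∃ b, ℓ a q < ℓ b q ∧ ∃ θ : ℝ, Dominates V ℓ a (p + θ • q) ∧ Dominates V ℓ b (p + θ • q) := by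
  have hne : {b | ℓ a q < ℓ b q}.Nonempty := by
    by_contra h
    rw [Set.not_nonempty_iff_eq_empty, Set.eq_empty_iff_forall_notMem] at h
    exact hqa ⟨hq, hq0, fun b => not_lt.1 (h b)⟩
  obtain ⟨b, hb, hmin⟩ := Set.exists_min_image {b | ℓ a q < ℓ b q}
    (fun b => (ℓ a p - ℓ b p) / (ℓ b q - ℓ a q)) (Set.toFinite _) hne
  have hb' : 0 < ℓ b q - ℓ a q := sub_pos.2 hb
  set θ := (ℓ a p - ℓ b p) / (ℓ b q - ℓ a q) with hθ
  have hθ0 : 0 ≤ θ := div_nonneg (sub_nonneg.2 (hp.2.2 b)) hb'.le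
  have hmem : p + θ • q ∈ V := by
    rcases hθ0.eq_or_lt with h | h
    · simpa [← h] using hp.1
    · exact V.add_mem hp.1 (V.smul_mem h hq)
  have hne0 : p + θ • q ≠ 0 := by
    rcases hθ0.eq_or_lt with h | h
    · simpa [← h] using hp.2.1
    · exact add_ne_zero_of_salient hV hp.1 hp.2.1 (V.smul_mem h hq)
  have hab : ℓ a (p + θ • q) = ℓ b (p + θ • q) := by
    have : θ * (ℓ b q - ℓ a q) = ℓ a p - ℓ b p := div_mul_cancel₀ _ hb'.ne'
    simp only [map_add, map_smul, smul_eq_mul]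
    linarith
  have hle : ∀ d, ℓ d (p + θ • q) ≤ ℓ a (p + θ • q) := by
    intro d
    simp only [map_add, map_smul, smul_eq_mul]
    rcases lt_or_ge (ℓ a q) (ℓ d q) with h | h
    · have h1 : θ ≤ (ℓ a p - ℓ d p) / (ℓ d q - ℓ a q) := hmin d h
      rw [le_div_iff₀ (sub_pos.2 h)] at h1
      linarith
    · have := mul_le_mul_of_nonneg_left h hθ0
      linarith [hp.2.2 d]
  exact ⟨b, hb, θ, ⟨hmem, hne0, hle⟩, ⟨hmem, hne0, fun d => hab ▸ hle d⟩⟩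

/-- Travel from the region of `a` towards a vector dominated by `b`: either that vector lies in both
regions, or the functional first overtaking `a` is a neighbour. -/
theorem exists_adjacent [Finite ρ] (hV : V.Salient) (hdom : ∀ a, ∃ v, Dominates V ℓ a v)
    (hab : b ≠ a) : ∃ c, c ≠ a ∧ Adjacent V ℓ a c := by
  obtain ⟨p, hp⟩ := hdom a
  obtain ⟨q, hq⟩ := hdom b
  by_cases hqa : Dominates V ℓ a q
  · exact ⟨b, hab, q, hqa, hq⟩
  · obtain ⟨c, hc, θ, h₁, h₂⟩ := exists_crossing hV hp hq.1 hq.2.1 hqa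
    exact ⟨c, fun h => by simp [h] at hc, _, h₁, h₂⟩

/-- Three pairwise adjacent functionals, if there are no others, are simultaneously maximal at
some vector. -/
theorem exists_dominates_three (hV : V.Salient) (hρ : ∀ d, d = a ∨ d = b ∨ d = c)
    (hab : Adjacent V ℓ a b) (hbc : Adjacent V ℓ b c) (hac : Adjacent V ℓ a c) :
    ∃ v, Dominates V ℓ a v ∧ Dominates V ℓ b v ∧ Dominates V ℓ c v := by
  obtain ⟨p, hpa, hpb⟩ := hab
  obtain ⟨q, hqb, hqc⟩ := hbc
  obtain ⟨r, hra, hrc⟩ := hac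
  have eqp := le_antisymm (hpb.2.2 a) (hpa.2.2 b)
  have eqq := le_antisymm (hqc.2.2 b) (hqb.2.2 c)
  have eqr := le_antisymm (hrc.2.2 a) (hra.2.2 c)
  rcases (hpa.2.2 c).eq_or_lt with hp | hp
  · exact ⟨p, hpa, hpb, hpa.1, hpa.2.1, fun d => hp ▸ hpa.2.2 d⟩
  rcases (hqb.2.2 a).eq_or_lt with hq | hq
  · exact ⟨q, ⟨hqb.1, hqb.2.1, fun d => hq ▸ hqb.2.2 d⟩, hqb, hqc⟩
  rcases (hra.2.2 b).eq_or_lt with hr | hr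
  · exact ⟨r, hra, ⟨hra.1, hra.2.1, fun d => hr ▸ hra.2.2 d⟩, hrc⟩
  have hp' := sub_pos.2 hp
  have hq' := sub_pos.2 hq
  have hr' := sub_pos.2 hr
  -- Each of `p`, `q`, `r` is rescaled so that its one non-maximal functional lags by exactly 1; in
  -- the sum every functional lags once, so all three agree.
  set u := (ℓ a p - ℓ c p)⁻¹ • p + ((ℓ b q - ℓ a q)⁻¹ • q + (ℓ a r - ℓ b r)⁻¹ • r) with hu
  have hup := V.smul_mem (inv_pos.2 hp') hpa.1
  have huq := V.add_mem (V.smul_mem (inv_pos.2 hq') hqb.1) (V.smul_mem (inv_pos.2 hr') hra.1)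
  have hmem : u ∈ V := V.add_mem hup huq
  have hne : u ≠ 0 :=
    add_ne_zero_of_salient hV hup (smul_ne_zero (inv_pos.2 hp').ne' hpa.2.1) huq
  have e1 : (ℓ a p - ℓ c p)⁻¹ * (ℓ a p - ℓ c p) = 1 := inv_mul_cancel₀ hp'.ne'
  have e2 : (ℓ b q - ℓ a q)⁻¹ * (ℓ b q - ℓ a q) = 1 := inv_mul_cancel₀ hq'.ne'
  have e3 : (ℓ a r - ℓ b r)⁻¹ * (ℓ a r - ℓ b r) = 1 := inv_mul_cancel₀ hr'.ne'
  have hba : ℓ b u = ℓ a u := by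
    simp only [hu, map_add, map_smul, smul_eq_mul]
    rw [← eqp]
    linarith
  have hca : ℓ c u = ℓ a u := by
    simp only [hu, map_add, map_smul, smul_eq_mul]
    rw [← eqr, ← eqq]
    linarith
  have key : ∀ d, ℓ d u = ℓ a u := by
    intro d
    rcases hρ d with rfl | rfl | rfl
    · rfl
    · exact hba
    · exact hca
  exact ⟨u, ⟨hmem, hne, fun d => (key d).le⟩, ⟨hmem, hne, fun d => by rw [key d, key b]⟩,
    ⟨hmem, hne, fun d => by rw [key d, key c]⟩⟩

variable {κ : Type*} [Fintype κ] {e : κ → E}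

/-- A functional with a single neighbour is maximal at some generator of the cone. -/
theorem exists_dominates_generator [Finite ρ] (hV : V.Salient) (he : ∀ i, e i ∈ V)
    (he0 : ∀ i, e i ≠ 0) (hgen : ∀ v ∈ V, ∃ t : κ → ℝ, (∀ i, 0 ≤ t i) ∧ v = ∑ i, t i • e i)
    (hdom : ∃ v, Dominates V ℓ a v) (hnbr : ∀ d, d ≠ a → Adjacent V ℓ a d → d = b) :
    ∃ i, Dominates V ℓ a (e i) := by
  obtain ⟨p, hp⟩ := hdom
  by_contra! hcon
  -- Towards every generator the first functional to overtake `a` can only be `b`; by nonnegative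
  -- combination `b` then beats `a` at `p`.
  have hlt : ∀ i, ℓ a (e i) < ℓ b (e i) := by
    intro i
    obtain ⟨d, hd, θ, h₁, h₂⟩ := exists_crossing hV hp (he i) (he0 i) (hcon i)
    have := hnbr d (fun h => by simp [h] at hd) ⟨_, h₁, h₂⟩
    exact this ▸ hd
  obtain ⟨t, ht, rfl⟩ := hgen p hp.1
  have hne : ∃ i, t i ≠ 0 := by
    by_contra! h
    exact hp.2.1 (by simp [h])
  obtain ⟨i, hi⟩ := hne
  refine (hp.2.2 b).not_gt ?_
  simp only [map_sum, map_smul, smul_eq_mul]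
  exact Finset.sum_lt_sum (fun j _ => mul_le_mul_of_nonneg_left (hlt j).le (ht j))
    ⟨i, Finset.mem_univ _, mul_lt_mul_of_pos_left (hlt i) ((ht i).lt_of_ne' hi)⟩

/-- If `a` and `c` both have `b` as their only neighbour, then two vectors supported on disjoint
sets of generators suffice for `a`, `b` and `c`. -/
theorem exists_disjoint_support_of_leaves [Finite ρ] (hV : V.Salient) (he : ∀ i, e i ∈ V)
    (he0 : ∀ i, e i ≠ 0) (hgen : ∀ v ∈ V, ∃ t : κ → ℝ, (∀ i, 0 ≤ t i) ∧ v = ∑ i, t i • e i)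
    (hκ : 3 ≤ Fintype.card κ) (hdom : ∀ a, ∃ v, Dominates V ℓ a v) (hcb : c ≠ b) (hca : c ≠ a)
    (ha : ∀ d, d ≠ a → Adjacent V ℓ a d → d = b) (hc : ∀ d, d ≠ c → Adjacent V ℓ c d → d = b) :
    ∃ (w : E) (i j g : κ) (θ : ℝ), g ≠ i ∧ g ≠ j ∧ w = e i + θ • e j ∧
      ((Dominates V ℓ a w ∧ Dominates V ℓ b w ∧ Dominates V ℓ c (e g)) ∨
       (Dominates V ℓ c w ∧ Dominates V ℓ b w ∧ Dominates V ℓ a (e g))) := by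
  classical
  obtain ⟨i, hi⟩ := exists_dominates_generator hV he he0 hgen (hdom a) ha
  obtain ⟨g, hg⟩ := exists_dominates_generator hV he he0 hgen (hdom c) hc
  have hgi : ∀ j, Dominates V ℓ c (e j) → ¬ Dominates V ℓ a (e j) :=
    fun j h h' => hcb (ha c hca ⟨_, h', h⟩)
  have hne : g ≠ i := fun h => hgi g hg (h ▸ hi)
  obtain ⟨j, -, hj⟩ : ∃ j ∈ (Finset.univ : Finset κ), j ∉ ({i, g} : Finset κ) := by
    apply Finset.exists_mem_notMem_of_card_lt_card
    have := Finset.card_le_two (a := i) (b := g)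
    rw [Finset.card_univ]
    omega
  simp only [Finset.mem_insert, Finset.mem_singleton, not_or] at hj
  -- The third generator `e j` lies outside the region of at least one leaf; the crossing is made
  -- from that leaf's generator towards `e j`, and the other leaf keeps its own generator.
  by_cases hja : Dominates V ℓ a (e j)
  · obtain ⟨d, hd, θ, h₁, h₂⟩ := exists_crossing hV hg (he j) (he0 j) (fun h => hgi j h hja)
    have := hc d (fun h => by simp [h] at hd) ⟨_, h₁, h₂⟩
    subst this
    exact ⟨_, g, j, i, θ, hne.symm, Ne.symm hj.1, rfl, Or.inr ⟨h₁, h₂, hi⟩⟩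
  · obtain ⟨d, hd, θ, h₁, h₂⟩ := exists_crossing hV hi (he j) (he0 j) hja
    have := ha d (fun h => by simp [h] at hd) ⟨_, h₁, h₂⟩
    subst this
    exact ⟨_, i, j, g, θ, hne, Ne.symm hj.2, rfl, Or.inl ⟨h₁, h₂, hg⟩⟩

end Dominance

/-! ### Vertices of polyhedra, feasible directions and slack-normalized functionals. -/

section Polyhedron

variable {E ι : Type*} [NormedAddCommGroup E] [NormedSpace ℝ E]

/-- The solution set of a system of linear inequalities. -/
def polyhedron (f : ι → E →L[ℝ] ℝ) (h : ι → ℝ) : Set E := {x | ∀ i, f i x ≤ h i}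

variable {f : ι → E →L[ℝ] ℝ} {h : ι → ℝ}

theorem mem_polyhedron {x : E} : x ∈ polyhedron f h ↔ ∀ i, f i x ≤ h i := Iff.rfl

theorem isClosed_polyhedron : IsClosed (polyhedron f h) := by
  simp only [polyhedron, Set.ofPred_forall]
  exact isClosed_iInter fun i => isClosed_le (f i).continuous continuous_const

theorem convex_polyhedron : Convex ℝ (polyhedron f h) := by
  simp only [polyhedron, Set.ofPred_forall]
  exact convex_iInter fun i => convex_halfSpace_le (f i).isLinear _

theorem eventually_lt_of_lt [Finite ι] (x v : E) :
    ∀ᶠ ε : ℝ in nhds 0, ∀ i, f i x < h i → f i (x + ε • v) < h i := by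
  refine Filter.eventually_all.2 fun i => ?_
  by_cases hi : f i x < h i
  · have : Filter.Tendsto (fun ε : ℝ => f i (x + ε • v)) (nhds 0) (nhds (f i x)) := by
      have hc : Continuous fun ε : ℝ => f i (x + ε • v) := by fun_prop
      simpa using hc.tendsto 0
    exact (this.eventually_lt_const hi).mono fun ε hε _ => hε
  · exact Filter.Eventually.of_forall fun ε h' => absurd h' hi

theorem exists_pos_lt_of_lt [Finite ι] (x v w : E) :
    ∃ ε : ℝ, 0 < ε ∧ ∀ i, f i x < h i → f i (x + ε • v) < h i ∧ f i (x + ε • w) < h i := by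
  have h1 := ((eventually_lt_of_lt (f := f) (h := h) x v).and
    (eventually_lt_of_lt (f := f) (h := h) x w)).filter_mono
      (nhdsWithin_le_nhds (s := Set.Ioi (0 : ℝ)))
  obtain ⟨ε, ⟨h₁, h₂⟩, hε⟩ := (h1.and self_mem_nhdsWithin).exists
  exact ⟨ε, hε, fun i hi => ⟨h₁ i hi, h₂ i hi⟩⟩

/-- The cone of feasible directions of a polyhedron at the point `x`. -/
def feasibleCone (f : ι → E →L[ℝ] ℝ) (h : ι → ℝ) (x : E) : ConvexCone ℝ E where
  carrier := {v | ∀ i, f i x = h i → f i v ≤ 0}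
  smul_mem' c hc v hv i hi := by
    simpa using mul_nonpos_of_nonneg_of_nonpos hc.le (hv i hi)
  add_mem' v hv w hw i hi := by
    simpa using add_nonpos (hv i hi) (hw i hi)

theorem mem_feasibleCone {x v : E} :
    v ∈ feasibleCone f h x ↔ ∀ i, f i x = h i → f i v ≤ 0 := Iff.rfl

/-- The functionals of the constraints that are not tight at `x`, normalized by their slack. -/
noncomputable def slackFunctional (f : ι → E →L[ℝ] ℝ) (h : ι → ℝ) (x : E)
    (a : {i // f i x < h i}) : E →ₗ[ℝ] ℝ :=
  (h a - f a x)⁻¹ • (f a : E →ₗ[ℝ] ℝ)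

theorem slackFunctional_apply (x : E) (a : {i // f i x < h i}) (v : E) :
    slackFunctional f h x a v = f a v / (h a - f a x) := by
  simp [slackFunctional, div_eq_inv_mul]

/-- Otherwise `x` would be the midpoint of a short segment in direction `v` inside the polyhedron.
-/
theorem eq_zero_of_mem_feasibleCone [Finite ι] {x : E}
    (hx : x ∈ (polyhedron f h).extremePoints ℝ) {v : E}
    (hv : ∀ i, f i x = h i → f i v = 0) : v = 0 := by
  by_contra hv0
  obtain ⟨ε, hε, hlt⟩ := exists_pos_lt_of_lt (f := f) (h := h) x v (-v)
  have hmem : ∀ i, f i (x + ε • v) ≤ h i ∧ f i (x + ε • -v) ≤ h i := by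
    intro i
    rcases (hx.1 i).lt_or_eq with hi | hi
    · exact ⟨(hlt i hi).1.le, (hlt i hi).2.le⟩
    · simp [hv i hi, hi]
  have := (mem_extremePoints.1 hx).2 _ (fun i => (hmem i).1) _ (fun i => (hmem i).2)
    (by
      refine ⟨1 / 2, 1 / 2, by norm_num, by norm_num, by norm_num, ?_⟩
      simp only [smul_add, smul_neg]
      rw [add_add_add_comm, add_neg_cancel, add_zero, ← add_smul]
      norm_num)
  have h1 : ε • v = 0 := by simpa using this.1
  exact (smul_ne_zero hε.ne' hv0) h1

theorem salient_feasibleCone [Finite ι] {x : E} (hx : x ∈ (polyhedron f h).extremePoints ℝ) :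
    (feasibleCone f h x).Salient := by
  intro v hv hv0 hnv
  refine hv0 (eq_zero_of_mem_feasibleCone hx fun i hi => le_antisymm (hv i hi) ?_)
  simpa using hnv i hi

theorem exists_slackFunctional_pos (hb : Bornology.IsBounded (polyhedron f h)) {x v : E}
    (hx : x ∈ polyhedron f h) (hv : v ∈ feasibleCone f h x) (hv0 : v ≠ 0) :
    ∃ a, 0 < slackFunctional f h x a v := by
  by_contra! hcon
  obtain ⟨M, hM⟩ := hb.exists_norm_le
  have hmem : ∀ t : ℝ, 0 ≤ t → x + t • v ∈ polyhedron f h := by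
    intro t ht i
    have hi : f i v ≤ 0 := by
      rcases (hx i).lt_or_eq with hi | hi
      · have := hcon ⟨i, hi⟩
        rw [slackFunctional_apply, div_le_iff₀ (sub_pos.2 hi), zero_mul] at this
        exact this
      · exact hv i hi
    have := mul_nonpos_of_nonneg_of_nonpos ht hi
    simp only [map_add, map_smul, smul_eq_mul]
    linarith [hx i]
  have hvn := norm_pos_iff.2 hv0
  have hM0 : 0 ≤ M := (norm_nonneg x).trans (hM x hx)
  -- This parameter displaces `x` by `M + ‖x‖ + 1`, beyond the norm bound `M`.
  have ht : 0 ≤ (M + ‖x‖ + 1) / ‖v‖ := by positivity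
  have h1 := hM _ (hmem _ ht)
  have h2 : ‖((M + ‖x‖ + 1) / ‖v‖) • v‖ = M + ‖x‖ + 1 := by
    rw [norm_smul, Real.norm_of_nonneg ht, div_mul_cancel₀ _ hvn.ne']
  have h3 := norm_sub_le (x + ((M + ‖x‖ + 1) / ‖v‖) • v) x
  rw [add_sub_cancel_left, h2] at h3
  linarith

/-- The ray `x + t • v` meets a slack constraint `b` with positive value at time `1 / ℓ b v`, so it
leaves the polyhedron at the reciprocal of the maximal value, through exactly the maximizing
constraints. Constraints tight at `x` and constant along `v` stay tight. -/
theorem exists_mem_polyhedron_of_dominates (hb : Bornology.IsBounded (polyhedron f h)) {x v : E}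
    (hx : x ∈ polyhedron f h) {a : {i // f i x < h i}}
    (hv : Dominates (feasibleCone f h x) (slackFunctional f h x) a v) :
    ∃ y ∈ polyhedron f h,
      (∀ b, Dominates (feasibleCone f h x) (slackFunctional f h x) b v → f b y = h b) ∧
      ∀ i, f i x = h i → f i v = 0 → f i y = h i := by
  set m := slackFunctional f h x a v with hm
  have hpos : 0 < m := by
    obtain ⟨b, hb⟩ := exists_slackFunctional_pos hb hx hv.1 hv.2.1
    exact hb.trans_le (hv.2.2 b)
  have hval : ∀ b : {i // f i x < h i},
      f b (x + m⁻¹ • v) = f b x + (h b - f b x) * (slackFunctional f h x b v / m) := by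
    intro b
    have := sub_pos.2 b.2
    rw [slackFunctional_apply]
    simp only [map_add, map_smul, smul_eq_mul]
    field_simp
  refine ⟨x + m⁻¹ • v, fun i => ?_, fun b hvb => ?_, fun i hi hi0 => by simp [hi, hi0]⟩
  · rcases (hx i).lt_or_eq with hi | hi
    · have h1 := hval ⟨i, hi⟩
      have h2 : slackFunctional f h x ⟨i, hi⟩ v / m ≤ 1 := (div_le_one hpos).2 (hv.2.2 _)
      have h3 := mul_le_mul_of_nonneg_left h2 (sub_pos.2 hi).le
      simp only at h1
      rw [h1]
      linarith
    · have := mul_nonpos_of_nonneg_of_nonpos (inv_pos.2 hpos).le (hv.1 i hi)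
      simp only [map_add, map_smul, smul_eq_mul]
      linarith
  · rw [hval, le_antisymm (hv.2.2 b) (hvb.2.2 a), ← hm, div_self hpos.ne']
    ring

/-- Aim at a point `y` touching `a`: the normalized functionals are at most 1 on `y - x`, and that
of `a` equals 1. -/
theorem exists_dominates {x : E} (hx : x ∈ polyhedron f h)
    (hatt : ∀ i, ∃ y ∈ polyhedron f h, f i y = h i) (a : {i // f i x < h i}) :
    ∃ v, Dominates (feasibleCone f h x) (slackFunctional f h x) a v := by
  obtain ⟨y, hy, hya⟩ := hatt a
  refine ⟨y - x, fun i hi => by simpa [hi] using hy i, fun h0 => ?_, fun b => ?_⟩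
  · rw [sub_eq_zero] at h0
    exact a.2.ne (h0 ▸ hya)
  · rw [slackFunctional_apply, slackFunctional_apply, map_sub, map_sub, hya,
      div_self (sub_pos.2 a.2).ne', div_le_one (sub_pos.2 b.2)]
    linarith [hy b]

/-- A set of points that touches the constraints in `J` can be completed, one point for each
missing constraint, to one that touches all of them. -/
theorem exists_finset_touching [Fintype ι] {k : ℕ}
    (hatt : ∀ i, ∃ y ∈ polyhedron f h, f i y = h i) (T₀ : Finset E) (J : Finset ι)
    (hT₀ : ∀ x ∈ T₀, x ∈ polyhedron f h) (hJ : ∀ i ∈ J, ∃ x ∈ T₀, f i x = h i)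
    (hcard : T₀.card + Fintype.card ι ≤ k + J.card) :
    ∃ T : Finset E, T.card ≤ k ∧ (∀ x ∈ T, x ∈ polyhedron f h) ∧
      ∀ i, ∃ x ∈ T, f i x = h i := by
  classical
  choose y hy hyi using hatt
  refine ⟨T₀ ∪ Jᶜ.image y, ?_, ?_, ?_⟩
  · have h1 := Finset.card_union_le T₀ (Jᶜ.image y)
    have h2 := Finset.card_image_le (s := Jᶜ) (f := y)
    have h3 := Finset.card_add_card_compl J
    omega
  · intro x hx
    rcases Finset.mem_union.1 hx with hx | hx
    · exact hT₀ x hx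
    · obtain ⟨i, -, rfl⟩ := Finset.mem_image.1 hx
      exact hy i
  · intro i
    by_cases hi : i ∈ J
    · obtain ⟨x, hx, hxi⟩ := hJ i hi
      exact ⟨x, Finset.mem_union_left _ hx, hxi⟩
    · exact ⟨y i, Finset.mem_union_right _ (Finset.mem_image_of_mem _ (Finset.mem_compl.2 hi)),
        hyi i⟩

end Polyhedron

/-! ### Touching all constraints with few points. -/

section Cover

variable {E ι : Type*} [NormedAddCommGroup E] [NormedSpace ℝ E] [Fintype ι]
  {f : ι → E →L[ℝ] ℝ} {h : ι → ℝ}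

theorem injective_pi_tight {x : E} (hx : x ∈ (polyhedron f h).extremePoints ℝ) :
    Function.Injective
      (LinearMap.pi fun i : {i // f i x = h i} => (f i : E →ₗ[ℝ] ℝ)) := by
  rw [injective_iff_map_eq_zero]
  intro v hv
  exact eq_zero_of_mem_feasibleCone hx fun i hi => congrFun hv ⟨i, hi⟩

theorem finrank_le_card_tight {x : E}
    [Fintype {i // f i x = h i}] (hx : x ∈ (polyhedron f h).extremePoints ℝ) :
    Module.finrank ℝ E ≤ Fintype.card {i // f i x = h i} := by
  have := LinearMap.finrank_le_finrank_of_injective (injective_pi_tight hx)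
  rwa [Module.finrank_fintype_fun_eq_card] at this

variable [FiniteDimensional ℝ E]

/-- At a simple vertex, the cone of feasible directions is generated by the edge directions. -/
theorem exists_generators_feasibleCone {x : E} [Fintype {i // f i x = h i}]
    [DecidableEq {i // f i x = h i}]
    (hx : x ∈ (polyhedron f h).extremePoints ℝ)
    (hcard : Fintype.card {i // f i x = h i} = Module.finrank ℝ E) :
    ∃ e : {i // f i x = h i} → E,
      (∀ i j : {i // f i x = h i}, f j (e i) = if j = i then -1 else 0) ∧
      ∀ v ∈ feasibleCone f h x, ∃ t : {i // f i x = h i} → ℝ,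
        (∀ i, 0 ≤ t i) ∧ v = ∑ i, t i • e i := by
  have hinj := injective_pi_tight hx
  have hfr : Module.finrank ℝ E = Module.finrank ℝ ({i // f i x = h i} → ℝ) := by
    rw [Module.finrank_fintype_fun_eq_card, hcard]
  have hsurj := (LinearMap.injective_iff_surjective_of_finrank_eq_finrank hfr).1 hinj
  choose e he using fun i => hsurj (Pi.single i (-1))
  have he' : ∀ i j : {i // f i x = h i}, f j (e i) = if j = i then -1 else 0 := by
    intro i j
    have := congrFun (he i) j
    rwa [Pi.single_apply] at this
  refine ⟨e, he', fun v hv => ⟨fun i => -f i v, fun i => ?_, hinj ?_⟩⟩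
  · simpa using hv i i.2
  · ext j
    simp [he']

/-- In dimension at least three, a bounded system of at most `n + k + 1` attained linear
inequalities is touched by some `k` of its solutions. -/
theorem exists_finset_card_le_touching {k : ℕ} (hdim : 3 ≤ Module.finrank ℝ E) (hk : 2 ≤ k)
    (hK : IsCompact (polyhedron f h)) (hne : (polyhedron f h).Nonempty)
    (hatt : ∀ i, ∃ y ∈ polyhedron f h, f i y = h i)
    (hcard : Fintype.card ι ≤ Module.finrank ℝ E + k + 1) :
    ∃ T : Finset E, T.card ≤ k ∧ (∀ x ∈ T, x ∈ polyhedron f h) ∧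
      ∀ i, ∃ x ∈ T, f i x = h i := by
  classical
  obtain ⟨x, hx⟩ := hK.extremePoints_nonempty hne
  have hb := hK.isBounded
  have hxK := hx.1
  have hV := salient_feasibleCone hx
  have hdom := exists_dominates hxK hatt
  have htouch := fun {a : {i // f i x < h i}} {v : E} =>
    exists_mem_polyhedron_of_dominates (a := a) (v := v) hb hxK
  set V := feasibleCone f h x
  set ℓ := slackFunctional f h x
  have hsum : Fintype.card {i // f i x = h i} + Fintype.card {i // f i x < h i}
      = Fintype.card ι := by
    have h1 := Fintype.card_subtype_compl (fun i => f i x = h i)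
    have h2 := Fintype.card_subtype_le (fun i => f i x = h i)
    have h3 : Fintype.card {i // f i x < h i} = Fintype.card {i // ¬ f i x = h i} :=
      Fintype.card_congr (Equiv.subtypeEquivRight fun i => (hxK i).lt_iff_ne)
    omega
  have hfr := finrank_le_card_tight hx
  -- Bookkeeping: once the constraints tight at `x` and those in `S` are touched by `T₀`, each
  -- remaining one costs one more point.
  have hdone : ∀ (T₀ : Finset E) (S : Finset {i // f i x < h i}),
      (∀ y ∈ T₀, y ∈ polyhedron f h) → (∀ i, f i x = h i → ∃ y ∈ T₀, f i y = h i) →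
      (∀ a ∈ S, ∃ y ∈ T₀, f a y = h a) → T₀.card + Fintype.card {i // f i x < h i} ≤ k + S.card →
      ∃ T : Finset E, T.card ≤ k ∧ (∀ x ∈ T, x ∈ polyhedron f h) ∧
        ∀ i, ∃ x ∈ T, f i x = h i := by
    intro T₀ S h₁ h₂ h₃ h₄
    have hdisj : Disjoint (Finset.univ.filter fun i => f i x = h i)
        (S.map (Function.Embedding.subtype _)) := by
      rw [Finset.disjoint_left]
      intro i hi hi'
      obtain ⟨a, -, rfl⟩ := Finset.mem_map.1 hi'
      exact a.2.ne (Finset.mem_filter.1 hi).2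
    refine exists_finset_touching hatt T₀
      ((Finset.univ.filter fun i => f i x = h i) ∪ S.map (Function.Embedding.subtype _)) h₁ ?_ ?_
    · intro i hi
      rcases Finset.mem_union.1 hi with hi | hi
      · exact h₂ i (Finset.mem_filter.1 hi).2
      · obtain ⟨a, ha, rfl⟩ := Finset.mem_map.1 hi
        exact h₃ a ha
    · rw [Finset.card_union_of_disjoint hdisj, Finset.card_map, ← Fintype.card_subtype]
      omega
  have hpair : ∀ {a b}, a ≠ b → ({a, b} : Finset {i // f i x < h i}).card = 2 :=
    fun hab => Finset.card_pair hab
  rcases le_or_gt (Fintype.card {i // f i x < h i}) 1 with h1 | h1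
  · refine hdone {x} ∅ (by simpa using hxK) (fun i hi => ⟨x, by simp, hi⟩) (by simp) ?_
    simp only [Finset.card_singleton, Finset.card_empty]
    omega
  obtain ⟨a₀, b₀, hab₀⟩ := Fintype.exists_pair_of_one_lt_card h1
  obtain ⟨a, haa, v, hv, hva⟩ := exists_adjacent hV hdom hab₀.symm
  rcases le_or_gt (Fintype.card {i // f i x < h i}) k with h2 | h2
  · obtain ⟨y, hy, hy₁, -⟩ := htouch hv
    refine hdone {x, y} {a₀, a} (by simp [hxK, hy]) (fun i hi => ⟨x, by simp, hi⟩)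
      (by simp [hy₁ _ hv, hy₁ _ hva]) ?_
    have := Finset.card_le_two (a := x) (b := y)
    rw [hpair haa.symm]
    omega
  -- a third constraint `c`, adjacent to one of the two
  obtain ⟨c, -, hc⟩ : ∃ c ∈ (Finset.univ : Finset {i // f i x < h i}),
      c ∉ ({a₀, a} : Finset {i // f i x < h i}) := by
    apply Finset.exists_mem_notMem_of_card_lt_card
    rw [hpair haa.symm, Finset.card_univ]
    omega
  simp only [Finset.mem_insert, Finset.mem_singleton, not_or] at hc
  by_cases hdis : ∃ a b c d, a ≠ b ∧ a ≠ c ∧ a ≠ d ∧ b ≠ c ∧ b ≠ d ∧ c ≠ d ∧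
      Adjacent V ℓ a b ∧ Adjacent V ℓ c d
  · obtain ⟨a, b, c, d, hab, hac, had, hbc, hbd, hcd, ⟨v, hva, hvb⟩, w, hwc, hwd⟩ := hdis
    obtain ⟨y, hy, hy₁, -⟩ := htouch hva
    obtain ⟨z, hz, hz₁, -⟩ := htouch hwc
    refine hdone {x, y, z} {a, b, c, d} (by simp [hxK, hy, hz]) (fun i hi => ⟨x, by simp, hi⟩)
      (by simp [hy₁ _ hva, hy₁ _ hvb, hz₁ _ hwc, hz₁ _ hwd]) ?_
    have := Finset.card_le_three (a := x) (b := y) (c := z)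
    have h4 : ({a, b, c, d} : Finset {i // f i x < h i}).card = 4 := by
      rw [Finset.card_insert_of_notMem (by simp [hab, hac, had]),
        Finset.card_insert_of_notMem (by simp [hbc, hbd]), hpair hcd]
    omega
  -- Without two disjoint edges, the edge at `c` must share an endpoint with the edge `a₀ a`, which
  -- gives a path of length two.
  obtain ⟨a, b, c, hab, hac, hbc, hAab, hAbc⟩ : ∃ a b c, a ≠ b ∧ a ≠ c ∧ b ≠ c ∧
      Adjacent V ℓ a b ∧ Adjacent V ℓ b c := by
    obtain ⟨d, hdc, hcd⟩ := exists_adjacent hV hdom (Ne.symm hc.1)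
    have hA : Adjacent V ℓ a₀ a := ⟨v, hv, hva⟩
    by_cases hd₁ : d = a₀
    · subst hd₁
      exact ⟨a, d, c, haa, Ne.symm hc.2, hdc, hA.symm, hcd.symm⟩
    by_cases hd₂ : d = a
    · subst hd₂
      exact ⟨a₀, d, c, haa.symm, Ne.symm hc.1, hdc, hA, hcd.symm⟩
    exact absurd ⟨a₀, a, c, d, haa.symm, Ne.symm hc.1, Ne.symm hd₁, Ne.symm hc.2, Ne.symm hd₂,
      hdc.symm, hA, hcd⟩ hdis
  have hthree : ({a, b, c} : Finset {i // f i x < h i}).card = 3 :=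
    Finset.card_eq_three.2 ⟨a, b, c, hab, hac, hbc, rfl⟩
  by_cases hAac : Adjacent V ℓ a c
  -- An edge at a fourth vertex would be disjoint from some side of the triangle.
  · have hρ : ∀ d, d = a ∨ d = b ∨ d = c := by
      intro d
      by_contra! hd
      obtain ⟨e, hed, hde⟩ := exists_adjacent hV hdom hd.1.symm
      by_cases ha : e = a
      · subst ha
        exact hdis ⟨d, e, b, c, hd.1, hd.2.1, hd.2.2, hab, hac, hbc, hde, hAbc⟩
      by_cases hb : e = b
      · subst hb
        exact hdis ⟨d, e, a, c, hd.2.1, hd.1, hd.2.2, hab.symm, hbc, hac, hde, hAac⟩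
      exact hdis ⟨d, e, a, b, hed.symm, hd.1, hd.2.1, ha, hb, hab, hde, hAab⟩
    obtain ⟨w, hwa, hwb, hwc⟩ := exists_dominates_three hV hρ hAab hAbc hAac
    obtain ⟨y, hy, hy₁, -⟩ := htouch hwa
    refine hdone {x, y} {a, b, c} (by simp [hxK, hy]) (fun i hi => ⟨x, by simp, hi⟩)
      (by simp [hy₁ _ hwa, hy₁ _ hwb, hy₁ _ hwc]) ?_
    have := Finset.card_le_two (a := x) (b := y)
    omega
  · have ha : ∀ d, d ≠ a → Adjacent V ℓ a d → d = b := by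
      intro d hda had
      by_contra hdb
      have hdc : d ≠ c := fun h => hAac (h ▸ had)
      exact hdis ⟨a, d, b, c, hda.symm, hab, hac, hdb, hdc, hbc, had, hAbc⟩
    have hc : ∀ d, d ≠ c → Adjacent V ℓ c d → d = b := by
      intro d hdc hcd
      by_contra hdb
      have hda : d ≠ a := fun h => hAac (h ▸ hcd.symm)
      exact hdis ⟨c, d, a, b, hdc.symm, hac.symm, hbc.symm, hda, hdb, hab, hcd, hAab⟩
    -- More than `k` constraints are slack and at least `n` are tight, out of at most `n + k + 1`:
    -- the vertex is simple.
    have hκ : Fintype.card {i // f i x = h i} = Module.finrank ℝ E := by omega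
    obtain ⟨e, he, hgen⟩ := exists_generators_feasibleCone hx hκ
    have heV : ∀ i, e i ∈ V := by
      intro i j hj
      rw [he i ⟨j, hj⟩]
      split_ifs <;> norm_num
    have he0 : ∀ i, e i ≠ 0 := by
      intro i hi
      have := he i i
      simp [hi] at this
    obtain ⟨w, i, j, g, θ, hgi, hgj, rfl, hw⟩ := exists_disjoint_support_of_leaves hV heV he0 hgen
      (by omega) hdom hbc.symm hac.symm ha hc
    -- `y` can lose only the tight constraints `i` and `j`, and `z` only `g`, so together they
    -- replace `x`: two points for the tight constraints and `a`, `b`, `c`.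
    have key : ∀ y z : E, y ∈ polyhedron f h → z ∈ polyhedron f h →
        (∀ l, f l x = h l → f l (e i + θ • e j) = 0 → f l y = h l) →
        (∀ l, f l x = h l → f l (e g) = 0 → f l z = h l) →
        (∀ d ∈ ({a, b, c} : Finset {i // f i x < h i}), f d y = h d ∨ f d z = h d) →
        ∃ T : Finset E, T.card ≤ k ∧ (∀ x ∈ T, x ∈ polyhedron f h) ∧
          ∀ i, ∃ x ∈ T, f i x = h i := by
      intro y z hy hz h₁ h₂ h₃
      refine hdone {y, z} {a, b, c} (by simp [hy, hz]) (fun l hl => ?_) (fun d hd => ?_) ?_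
      · by_cases hlg : l = g
        · refine ⟨y, by simp, h₁ l hl ?_⟩
          have hi := he i ⟨l, hl⟩
          have hj := he j ⟨l, hl⟩
          rw [if_neg (fun h => hgi (Subtype.ext (hlg ▸ congrArg Subtype.val h)))] at hi
          rw [if_neg (fun h => hgj (Subtype.ext (hlg ▸ congrArg Subtype.val h)))] at hj
          simp only at hi hj
          simp [hi, hj]
        · refine ⟨z, by simp, h₂ l hl ?_⟩
          have := he g ⟨l, hl⟩
          rwa [if_neg (fun h => hlg (congrArg Subtype.val h))] at this
      · rcases h₃ d hd with h | h
        · exact ⟨y, by simp, h⟩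
        · exact ⟨z, by simp, h⟩
      · have := Finset.card_le_two (a := y) (b := z)
        omega
    rcases hw with ⟨h₁, h₂, h₃⟩ | ⟨h₁, h₂, h₃⟩ <;>
    · obtain ⟨y, hy, hy₁, hy₂⟩ := htouch h₁
      obtain ⟨z, hz, hz₁, hz₂⟩ := htouch h₃
      refine key y z hy hz hy₂ hz₂ ?_
      simp [hy₁ _ h₁, hy₁ _ h₂, hz₁ _ h₃]

end Cover

/-! ### Polytopes as irredundant systems of inequalities, by polarity. -/

section Representation

variable {E ι : Type*} [NormedAddCommGroup E]

/-- A vertex is determined by its set of tight constraints. -/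
theorem finite_extremePoints_polyhedron [NormedSpace ℝ E] [Finite ι] {f : ι → E →L[ℝ] ℝ}
    {h : ι → ℝ} : ((polyhedron f h).extremePoints ℝ).Finite := by
  refine Set.Finite.of_finite_image (f := fun x => {i | f i x = h i}) (Set.toFinite _) ?_
  intro x hx y _ hxy
  have : y - x = 0 := eq_zero_of_mem_feasibleCone hx fun i hi => by
    have hy : f i y = h i := (Set.ext_iff.1 hxy i).1 hi
    simp [hy, hi]
  exact (sub_eq_zero.1 this).symm

theorem exists_finite_polyhedron_eq_convexHull [NormedSpace ℝ E] [Finite ι] {f : ι → E →L[ℝ] ℝ}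
    {h : ι → ℝ} (hK : IsCompact (polyhedron f h)) :
    ∃ W : Set E, W.Finite ∧ polyhedron f h = convexHull ℝ W := by
  refine ⟨_, finite_extremePoints_polyhedron (f := f) (h := h), ?_⟩
  exact (closure_convexHull_extremePoints hK convex_polyhedron).symm.trans
    (finite_extremePoints_polyhedron.isClosed_convexHull ℝ).closure_eq

variable [InnerProductSpace ℝ E] [FiniteDimensional ℝ E]

/-- A full-dimensional polytope is the solution set of finitely many linear inequalities,
normalized at an interior point. -/
theorem exists_finset_convexHull_eq_halfSpaces {W : Set E} (hW : W.Finite) {c : E}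
    (hc : c ∈ interior (convexHull ℝ W)) :
    ∃ F : Finset E, convexHull ℝ W = {x | ∀ w ∈ F, inner ℝ w (x - c) ≤ 1} := by
  have := hW.to_subtype
  have hcW := interior_subset hc
  -- The polar of the polytope about `c`. It is compact, hence the hull of finitely many points, and
  -- these are the required normals by the bipolar argument.
  set P := polyhedron (fun w : W => innerSL ℝ ((w : E) - c)) (fun _ => 1) with hP
  have hPW : ∀ y ∈ P, ∀ x ∈ convexHull ℝ W, inner ℝ y (x - c) ≤ 1 := by
    intro y hy x hx
    have hsub : W ⊆ {x | innerSL ℝ y x ≤ 1 + inner ℝ y c} := by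
      intro w hw
      have := hy ⟨w, hw⟩
      rw [innerSL_apply_apply, real_inner_comm, inner_sub_right] at this
      rw [Set.mem_ofPred_eq, innerSL_apply_apply]
      linarith
    have := convexHull_min hsub (convex_halfSpace_le (innerSL ℝ y).isLinear _) hx
    simp only [innerSL_apply_apply, Set.mem_ofPred_eq] at this
    rw [inner_sub_right]
    linarith
  have hcomp : IsCompact P := by
    refine Metric.isCompact_of_isClosed_isBounded isClosed_polyhedron ?_
    obtain ⟨r, hr, hball⟩ := Metric.isOpen_iff.1 isOpen_interior c hc
    refine isBounded_iff_forall_norm_le.2 ⟨2 / r, fun y hy => ?_⟩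
    rcases eq_or_ne y 0 with rfl | hy0
    · simp only [norm_zero]
      positivity
    have hyn := norm_pos_iff.2 hy0
    have hmem : c + (r / 2 / ‖y‖) • y ∈ convexHull ℝ W := by
      refine interior_subset (hball ?_)
      rw [Metric.mem_ball, dist_eq_norm, add_sub_cancel_left, norm_smul,
        Real.norm_of_nonneg (by positivity), div_mul_cancel₀ _ hyn.ne']
      linarith
    have h1 := hPW y hy _ hmem
    rw [add_sub_cancel_left, inner_smul_right, real_inner_self_eq_norm_sq] at h1
    rw [le_div_iff₀ hr]
    have : r / 2 / ‖y‖ * ‖y‖ ^ 2 = r / 2 * ‖y‖ := by field_simp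
    linarith
  obtain ⟨F, hF, hPF⟩ := exists_finite_polyhedron_eq_convexHull hcomp
  refine ⟨hF.toFinset, Set.Subset.antisymm (fun x hx w hw => ?_) (fun x hx => ?_)⟩
  · refine hPW w ?_ x hx
    rw [hP, hPF]
    exact subset_convexHull ℝ F (hF.mem_toFinset.1 hw)
  · by_contra hxW
    obtain ⟨g, u, hg, hgx⟩ := geometric_hahn_banach_closed_point (convex_convexHull ℝ W)
      (hW.isClosed_convexHull ℝ) hxW
    have hu : 0 < u - g c := sub_pos.2 (hg c hcW)
    set y := (u - g c)⁻¹ • (InnerProductSpace.toDual ℝ E).symm g with hy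
    have hyv : ∀ v, inner ℝ y v = g v / (u - g c) := by
      intro v
      rw [hy, inner_smul_left, InnerProductSpace.toDual_symm_apply]
      simp [div_eq_inv_mul]
    have hyP : y ∈ P := by
      intro w
      rw [innerSL_apply_apply, real_inner_comm, hyv, map_sub, div_le_one hu]
      linarith [hg w (subset_convexHull ℝ W w.2)]
    rw [hP, hPF] at hyP
    have hsub : F ⊆ {y | innerSL ℝ (x - c) y ≤ 1} := by
      intro w hw
      have := hx w (hF.mem_toFinset.2 hw)
      rwa [Set.mem_ofPred_eq, innerSL_apply_apply, real_inner_comm]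
    have h1 := convexHull_min hsub (convex_halfSpace_le (innerSL ℝ (x - c)).isLinear _) hyP
    rw [Set.mem_ofPred_eq, innerSL_apply_apply, real_inner_comm, hyv, map_sub, div_le_one hu] at h1
    linarith

/-- A full-dimensional polytope is the solution set of an irredundant finite system of linear
inequalities: each of them has a solution of the system at which it is the only tight one. -/
theorem exists_irredundant_system {W : Set E} (hW : W.Finite) {c : E}
    (hc : c ∈ interior (convexHull ℝ W)) :
    ∃ (F : Finset E) (f : F → E →L[ℝ] ℝ) (h : F → ℝ), convexHull ℝ W = polyhedron f h ∧
      (∀ i, f i c < h i) ∧ ∀ i, ∃ y, f i y = h i ∧ ∀ j, j ≠ i → f j y < h j := by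
  classical
  obtain ⟨F, hF, hmin⟩ := (measure (Finset.card (α := E))).wf.has_min
    {F | convexHull ℝ W = {x | ∀ w ∈ F, inner ℝ w (x - c) ≤ 1}}
    (exists_finset_convexHull_eq_halfSpaces hW hc)
  refine ⟨F, fun w => innerSL ℝ (w : E), fun w => 1 + inner ℝ (w : E) c, ?_, by simp, ?_⟩
  · rw [hF]
    ext x
    simp [mem_polyhedron, inner_sub_right]
  · intro i
    obtain ⟨x, hx, hxi⟩ : ∃ x, (∀ w ∈ F.erase i, inner ℝ w (x - c) ≤ 1) ∧
        1 < inner ℝ (i : E) (x - c) := by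
      by_contra! hcon
      refine hmin (F.erase i) ?_ (Finset.card_erase_lt_of_mem i.2)
      change convexHull ℝ W = _
      rw [hF]
      ext x
      refine ⟨fun hx w hw => hx w (Finset.mem_of_mem_erase hw), fun hx w hw => ?_⟩
      by_cases hwi : w = i
      · exact hwi ▸ hcon x hx
      · exact hx w (Finset.mem_erase.2 ⟨hwi, hw⟩)
    have hpos : 0 < inner ℝ (i : E) (x - c) := one_pos.trans hxi
    -- `x` violates only constraint `i`; this is where the segment from `c` to `x` crosses its
    -- hyperplane.
    refine ⟨c + (inner ℝ (i : E) (x - c))⁻¹ • (x - c), ?_, fun j hj => ?_⟩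
    · rw [innerSL_apply_apply, inner_add_right, inner_smul_right, inv_mul_cancel₀ hpos.ne',
        add_comm]
    · have h1 := hx j (Finset.mem_erase.2 ⟨fun h => hj (Subtype.ext h), j.2⟩)
      have h2 : (inner ℝ (i : E) (x - c))⁻¹ * inner ℝ (j : E) (x - c) < 1 := by
        rw [inv_mul_lt_iff₀ hpos]
        linarith
      rw [innerSL_apply_apply, inner_add_right, inner_smul_right]
      linarith

end Representation

/-! ### Facets correspond to irredundant inequalities. -/

section Facets

variable {n : ℕ} {ι : Type*} [Fintype ι] {f : ι → EuclideanSpace ℝ (Fin n) →L[ℝ] ℝ} {h : ι → ℝ}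
  {c : EuclideanSpace ℝ (Fin n)}

theorem vectorSpan_eq_ker {i : ι} {y : EuclideanSpace ℝ (Fin n)} (hyi : f i y = h i)
    (hy : ∀ j, j ≠ i → f j y < h j) :
    vectorSpan ℝ {x | x ∈ polyhedron f h ∧ f i x = h i}
      = LinearMap.ker (f i : EuclideanSpace ℝ (Fin n) →ₗ[ℝ] ℝ) := by
  apply le_antisymm
  · rw [vectorSpan_def, Submodule.span_le]
    rintro _ ⟨x, hx, z, hz, rfl⟩
    simp [hx.2, hz.2]
  · intro v hv
    have hv : f i v = 0 := hv
    obtain ⟨ε, hε, hlt⟩ := exists_pos_lt_of_lt (f := f) (h := h) y v v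
    have hmem : y + ε • v ∈ {x | x ∈ polyhedron f h ∧ f i x = h i} := by
      refine ⟨fun j => ?_, by simp [hv, hyi]⟩
      by_cases hj : j = i
      · subst hj
        simp [hv, hyi]
      · exact (hlt j (hy j hj)).1.le
    have hymem : y ∈ {x | x ∈ polyhedron f h ∧ f i x = h i} := by
      refine ⟨fun j => ?_, hyi⟩
      by_cases hj : j = i
      · exact hj ▸ hyi.le
      · exact (hy j hj).le
    have := vsub_mem_vectorSpan ℝ hmem hymem
    rw [vsub_eq_sub, add_sub_cancel_left] at this
    rwa [Submodule.smul_mem_iff _ hε.ne'] at this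

theorem finrank_vectorSpan_facet (hc : ∀ i, f i c < h i) {i : ι} {y : EuclideanSpace ℝ (Fin n)}
    (hyi : f i y = h i) (hy : ∀ j, j ≠ i → f j y < h j) :
    Module.finrank ℝ (vectorSpan ℝ {x | x ∈ polyhedron f h ∧ f i x = h i}) + 1 = n := by
  rw [vectorSpan_eq_ker hyi hy]
  have hf : (f i : EuclideanSpace ℝ (Fin n) →ₗ[ℝ] ℝ) ≠ 0 := by
    intro h0
    have h1 : f i y = 0 := LinearMap.congr_fun h0 y
    have h2 : f i c = 0 := LinearMap.congr_fun h0 c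
    have := hc i
    linarith
  have := Module.Dual.finrank_ker_add_one_of_ne_zero hf
  rwa [finrank_euclideanSpace_fin] at this

theorem exists_facet_eq (hc : ∀ i, f i c < h i)
    (hirr : ∀ i, ∃ y, f i y = h i ∧ ∀ j, j ≠ i → f j y < h j)
    {F : Set (EuclideanSpace ℝ (Fin n))} (hF : F ∈ facets (polyhedron f h)) :
    ∃ i, F = {x | x ∈ polyhedron f h ∧ f i x = h i} := by
  obtain ⟨hne, hexp, hrank⟩ := hF
  obtain ⟨l, hl⟩ := hexp hne
  have hFP : F ⊆ polyhedron f h := by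
    rw [hl]
    exact fun x hx => hx.1
  -- Otherwise averaging points of `F` that are slack for each constraint gives an interior point in
  -- `F`; the exposing functional vanishes, so `F` is everything and has dimension `n`.
  obtain ⟨i, hi⟩ : ∃ i, ∀ z ∈ F, f i z = h i := by
    by_contra! hcon
    choose z hz hzi using hcon
    obtain ⟨w, hwF, hw⟩ : ∃ w ∈ F, ∀ i, f i w < h i := by
      rcases isEmpty_or_nonempty ι with hι | hι
      · obtain ⟨w, hw⟩ := hne
        exact ⟨w, hw, fun i => hι.elim i⟩
      have hcard : (0 : ℝ) < Fintype.card ι := by exact_mod_cast Fintype.card_pos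
      have hconv : Convex ℝ F := hexp.convex convex_polyhedron
      refine ⟨∑ i, (Fintype.card ι : ℝ)⁻¹ • z i,
        hconv.sum_mem (fun _ _ => by positivity) ?_ fun i _ => hz i, fun j => ?_⟩
      · simp [hcard.ne']
      · have h1 : ∑ i, f j (z i) < ∑ _i : ι, h j :=
          Finset.sum_lt_sum (fun i _ => hFP (hz i) j)
            ⟨j, Finset.mem_univ _, (hFP (hz j) j).lt_of_ne (hzi j)⟩
        simp only [map_sum, map_smul, smul_eq_mul, ← Finset.mul_sum]
        rw [inv_mul_lt_iff₀ hcard]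
        simpa using h1
    have hl0 : ∀ v, l v ≤ 0 := by
      intro v
      obtain ⟨ε, hε, hlt⟩ := exists_pos_lt_of_lt (f := f) (h := h) w v v
      have hwl : ∀ y ∈ polyhedron f h, l y ≤ l w := by
        rw [hl] at hwF
        exact hwF.2
      have := hwl (w + ε • v) fun i => (hlt i (hw i)).1.le
      simp only [map_add, map_smul, smul_eq_mul] at this
      exact nonpos_of_mul_nonpos_right (by linarith) hε
    have hl1 : ∀ v, l v = 0 := fun v => le_antisymm (hl0 v) (by simpa using hl0 (-v))
    have hFeq : F = polyhedron f h := by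
      rw [hl]
      ext x
      simp [hl1]
    have htop : vectorSpan ℝ F = ⊤ := by
      rw [eq_top_iff]
      intro v _
      obtain ⟨ε, hε, hlt⟩ := exists_pos_lt_of_lt (f := f) (h := h) c v v
      have hm : c + ε • v ∈ F := hFeq ▸ fun i => (hlt i (hc i)).1.le
      have hcm : c ∈ F := hFeq ▸ fun i => (hc i).le
      have := vsub_mem_vectorSpan ℝ hm hcm
      rw [vsub_eq_sub, add_sub_cancel_left] at this
      rwa [Submodule.smul_mem_iff _ hε.ne'] at this
    rw [htop, finrank_top, finrank_euclideanSpace_fin] at hrank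
    omega
  refine ⟨i, Set.Subset.antisymm (fun z hz => ⟨hFP hz, hi z hz⟩) ?_⟩
  obtain ⟨y, hyi, hy⟩ := hirr i
  have hle : vectorSpan ℝ F ≤ vectorSpan ℝ {x | x ∈ polyhedron f h ∧ f i x = h i} :=
    vectorSpan_mono ℝ fun z hz => ⟨hFP hz, hi z hz⟩
  have heq := Submodule.eq_of_le_of_finrank_eq hle (by
    have := finrank_vectorSpan_facet hc hyi hy
    omega)
  have hker : vectorSpan ℝ F ≤ LinearMap.ker (l : EuclideanSpace ℝ (Fin n) →ₗ[ℝ] ℝ) := by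
    rw [vectorSpan_def, Submodule.span_le]
    rintro _ ⟨x, hx, z, hz, rfl⟩
    rw [hl] at hx hz
    simp [le_antisymm (hz.2 x hx.1) (hx.2 z hz.1)]
  obtain ⟨w, hw⟩ := hne
  intro x hx
  have hxw : x - w ∈ vectorSpan ℝ F := by
    rw [heq, ← vsub_eq_sub]
    exact vsub_mem_vectorSpan ℝ hx ⟨hFP hw, hi w hw⟩
  have hlx : l x = l w := by
    have : l (x - w) = 0 := hker hxw
    rwa [map_sub, sub_eq_zero] at this
  rw [hl] at hw ⊢
  exact ⟨hx.1, fun v hv => hlx ▸ hw.2 v hv⟩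

/-- The facets of a polyhedron given by an irredundant system correspond to the inequalities. -/
theorem encard_facets_polyhedron (hc : ∀ i, f i c < h i)
    (hirr : ∀ i, ∃ y, f i y = h i ∧ ∀ j, j ≠ i → f j y < h j) :
    (facets (polyhedron f h)).encard = Fintype.card ι := by
  have hrange : facets (polyhedron f h)
      = (fun i => {x | x ∈ polyhedron f h ∧ f i x = h i}) '' Set.univ := by
    apply Set.Subset.antisymm
    · intro F hF
      obtain ⟨i, rfl⟩ := exists_facet_eq hc hirr hF
      exact ⟨i, trivial, rfl⟩
    · rintro _ ⟨i, -, rfl⟩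
      obtain ⟨y, hyi, hy⟩ := hirr i
      have hyP : y ∈ polyhedron f h := fun j => by
        by_cases hj : j = i
        · exact hj ▸ hyi.le
        · exact (hy j hj).le
      refine ⟨⟨y, hyP, hyi⟩, fun _ => ⟨f i, ?_⟩, finrank_vectorSpan_facet hc hyi hy⟩
      ext x
      refine ⟨fun hx => ⟨hx.1, fun z hz => (hz i).trans_eq hx.2.symm⟩, fun hx => ⟨hx.1, ?_⟩⟩
      exact le_antisymm (hx.1 i) (hyi ▸ hx.2 y hyP)
  have hinj : Function.Injective (fun i => {x | x ∈ polyhedron f h ∧ f i x = h i}) := by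
    intro i j hij
    by_contra hne
    obtain ⟨y, hyi, hy⟩ := hirr i
    have hyP : y ∈ polyhedron f h := fun j => by
      by_cases hj : j = i
      · exact hj ▸ hyi.le
      · exact (hy j hj).le
    have : y ∈ {x | x ∈ polyhedron f h ∧ f j x = h j} := by
      rw [← show {x | x ∈ polyhedron f h ∧ f i x = h i} = {x | x ∈ polyhedron f h ∧ f j x = h j}
        from hij]
      exact ⟨hyP, hyi⟩
    exact (hy j (Ne.symm hne)).ne this.2
  rw [hrange, hinj.encard_image, Set.encard_univ, ENat.card_eq_coe_fintype_card]

end Facets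

/-! ### Ball convex hulls and touching sets. -/

section BallHull

variable {n : ℕ} {ι : Type*} {f : ι → EuclideanSpace ℝ (Fin n) →L[ℝ] ℝ} {h : ι → ℝ}
  {C K : Set (EuclideanSpace ℝ (Fin n))}

theorem mem_vadd_polyhedron {v x : EuclideanSpace ℝ (Fin n)} :
    x ∈ v +ᵥ polyhedron f h ↔ ∀ i, f i x ≤ h i + f i v := by
  rw [Set.mem_vadd_set_iff_neg_vadd_mem, mem_polyhedron]
  simp [add_comm]

theorem ballHull_subset (hK : IsBallConvex C K) {A : Set (EuclideanSpace ℝ (Fin n))}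
    (hA : A ⊆ K) : ballHull C A ⊆ K := Set.sInter_subset_of_mem ⟨hK, hA⟩

theorem subset_ballHull (C A : Set (EuclideanSpace ℝ (Fin n))) : A ⊆ ballHull C A :=
  Set.subset_sInter fun _ hK => hK.2

theorem isBallConvex_vadd (C : Set (EuclideanSpace ℝ (Fin n))) (v : EuclideanSpace ℝ (Fin n)) :
    IsBallConvex C (v +ᵥ C) :=
  Or.inr <| Or.inr <| Set.Subset.antisymm (Set.subset_sInter fun _ hD => hD.2)
    (Set.sInter_subset_of_mem ⟨⟨v, rfl⟩, subset_rfl⟩)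

/-- The ball convex hull of a nonempty set contains every set which lies in all the translates
that contain the given set. -/
theorem subset_ballHull_of_forall_vadd {A : Set (EuclideanSpace ℝ (Fin n))} (hA : A.Nonempty)
    (hAK : ∀ v : EuclideanSpace ℝ (Fin n), A ⊆ v +ᵥ C → K ⊆ v +ᵥ C) : K ⊆ ballHull C A := by
  refine Set.subset_sInter fun L hL => ?_
  rcases hL.1 with h | h | h
  · exact absurd (h ▸ hL.2) (by simpa using hA.ne_empty)
  · simp [h]
  · rw [h]
    refine Set.subset_sInter ?_
    rintro D ⟨⟨v, rfl⟩, hLD⟩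
    exact hAK v (hL.2.trans hLD)

/-- Two points farther apart than the diameter of `C` lie in no common translate. -/
theorem univ_eq_ballHull_pair [Nontrivial (EuclideanSpace ℝ (Fin n))]
    (hC : Bornology.IsBounded C) :
    ∃ w : EuclideanSpace ℝ (Fin n), Set.univ = ballHull C {0, w} := by
  obtain ⟨M, hM⟩ := Metric.isBounded_iff.1 hC
  obtain ⟨w, hw⟩ := NormedSpace.exists_lt_norm ℝ (EuclideanSpace ℝ (Fin n)) M
  refine ⟨w, (Set.eq_univ_of_univ_subset ?_).symm⟩
  refine subset_ballHull_of_forall_vadd ⟨0, by simp⟩ fun v hv => ?_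
  have h0 := Set.mem_vadd_set_iff_neg_vadd_mem.1 (hv (Set.mem_insert 0 {w}))
  have h1 := Set.mem_vadd_set_iff_neg_vadd_mem.1 (hv (Set.mem_insert_of_mem 0 rfl))
  have := hM h1 h0
  rw [dist_vadd_cancel_left, dist_zero_right] at this
  exact absurd this hw.not_ge

theorem everyBallConvexGenerated_polyhedron [Fintype ι] {k : ℕ} (hn : 3 ≤ n) (hk : 2 ≤ k)
    (hC : IsCompact (polyhedron f h)) (hcard : Fintype.card ι ≤ n + k + 1) :
    EveryBallConvexGenerated (polyhedron f h) k := by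
  classical
  have hnt : Nontrivial (EuclideanSpace ℝ (Fin n)) := by
    apply Module.nontrivial_of_finrank_pos (R := ℝ)
    rw [finrank_euclideanSpace_fin]
    omega
  intro K hK
  rcases K.eq_empty_or_nonempty with rfl | hne
  · refine ⟨∅, by simp, (Set.subset_empty_iff.1 ?_).symm⟩
    exact ballHull_subset (Or.inl rfl) (by simp)
  by_cases hKv : ∃ v : EuclideanSpace ℝ (Fin n), K ⊆ v +ᵥ polyhedron f h
  swap
  · have hKu : K = Set.univ := by
      rcases hK with h | h | h
      · exact absurd h hne.ne_empty
      · exact h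
      · rw [h, Set.sInter_eq_univ]
        rintro D ⟨⟨v, rfl⟩, hD⟩
        exact absurd ⟨v, hD⟩ hKv
    obtain ⟨w, hw⟩ := univ_eq_ballHull_pair hC.isBounded
    refine ⟨{0, w}, Finset.card_le_two.trans hk, ?_⟩
    rw [hKu, hw]
    simp
  obtain ⟨v, hv⟩ := hKv
  have hKeq : K = ⋂₀ {D | (∃ v : EuclideanSpace ℝ (Fin n), D = v +ᵥ polyhedron f h) ∧ K ⊆ D} := by
    rcases hK with h | h | h
    · exact absurd h hne.ne_empty
    · refine absurd ((hC.vadd v).isBounded.subset hv) ?_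
      rw [h]
      exact NormedSpace.unbounded_univ ℝ _
    · exact h
  have hKc : IsCompact K := by
    refine (hC.vadd v).of_isClosed_subset ?_ hv
    rw [hKeq]
    refine isClosed_sInter ?_
    rintro D ⟨⟨w, rfl⟩, -⟩
    exact (hC.vadd w).isClosed
  choose y hyK hy using fun i => hKc.exists_isMaxOn hne (f i).continuous.continuousOn
  -- A translate contains `K` precisely when its bounds dominate the maxima of the `f i` on `K`.
  have hKP : K = polyhedron f fun i => f i (y i) := by
    refine Set.Subset.antisymm (fun x hx i => hy i hx) fun x hx => ?_
    rw [hKeq]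
    rintro D ⟨⟨w, rfl⟩, hD⟩
    exact mem_vadd_polyhedron.2 fun i => (hx i).trans (mem_vadd_polyhedron.1 (hD (hyK i)) i)
  obtain ⟨T, hTk, hTK, hT⟩ := exists_finset_card_le_touching (E := EuclideanSpace ℝ (Fin n))
    (f := f) (h := fun i => f i (y i)) (k := k)
    (by rwa [finrank_euclideanSpace_fin]) hk (hKP ▸ hKc) (hKP ▸ hne)
    (fun i => ⟨y i, hKP ▸ hyK i, rfl⟩) (by rwa [finrank_euclideanSpace_fin])
  have hTK' : (T : Set (EuclideanSpace ℝ (Fin n))) ⊆ K := fun x hx => by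
    rw [hKP]
    exact hTK x hx
  refine ⟨T, hTk, Set.Subset.antisymm ?_ (ballHull_subset hK hTK')⟩
  refine subset_ballHull_of_forall_vadd ?_ fun w hw x hx => mem_vadd_polyhedron.2 fun i => ?_
  · rcases isEmpty_or_nonempty ι with hι | ⟨⟨i⟩⟩
    · refine absurd hKc.isBounded ?_
      have : K = Set.univ := by
        rw [hKP]
        exact Set.eq_univ_of_forall fun x i => hι.elim i
      rw [this]
      exact NormedSpace.unbounded_univ ℝ _
    · obtain ⟨x, hx, -⟩ := hT i
      exact ⟨x, hx⟩
  · obtain ⟨t, ht, hti⟩ := hT i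
    exact (hy i hx).trans (hti ▸ mem_vadd_polyhedron.1 (hw ht) i)

theorem everyBallConvexGenerated_of_encard_facets_le {k : ℕ} (hn : 3 ≤ n) (hk : 2 ≤ k)
    (hC : IsFullPolytope C) (hcard : (facets C).encard ≤ ((n + k + 1 : ℕ) : ℕ∞)) :
    EveryBallConvexGenerated C k := by
  obtain ⟨⟨W, hW, rfl⟩, c, hc⟩ := hC
  obtain ⟨F, f, h, hCP, hfc, hirr⟩ := exists_irredundant_system hW hc
  have hcomp : IsCompact (convexHull ℝ W) := hW.isCompact_convexHull ℝ
  rw [hCP] at hcard hcomp ⊢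
  rw [encard_facets_polyhedron hfc hirr] at hcard
  exact everyBallConvexGenerated_polyhedron hn hk hcomp (by exact_mod_cast hcard)

/-- Doubling the right-hand sides of an irredundant system gives a polyhedron `C` for which the
original polyhedron is ball convex. -/
theorem isBallConvex_polyhedron_two_mul
    (hirr : ∀ i, ∃ y, f i y = h i ∧ ∀ j, j ≠ i → f j y < h j) :
    IsBallConvex (polyhedron f fun i => 2 * h i) (polyhedron f h) := by
  refine Or.inr <| Or.inr <| Set.Subset.antisymm (Set.subset_sInter fun _ hD => hD.2) ?_
  intro x hx i
  obtain ⟨y, hyi, hy⟩ := hirr i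
  have hyP : ∀ j, f j y ≤ h j := fun j => by
    by_cases hj : j = i
    · exact hj ▸ hyi.le
    · exact (hy j hj).le
  -- The bounds of this translate are `2 * h j - f j y ≥ h j`, with equality at `j = i`.
  have hmem := hx (-y +ᵥ polyhedron f fun i => 2 * h i) ⟨⟨_, rfl⟩, fun z hz =>
    mem_vadd_polyhedron.2 fun j => by
      rw [map_neg]
      linarith [hz j, hyP j]⟩
  have := mem_vadd_polyhedron.1 hmem i
  rw [map_neg] at this
  linarith

/-- If at every point of the polyhedron at most one of the inequalities in `J` is tight, then the
polyhedron is not the ball convex hull of fewer than `#J` points. -/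
theorem card_le_of_eq_ballHull [Finite ι] (J : Finset ι) {c : EuclideanSpace ℝ (Fin n)}
    (hc : ∀ i, f i c < h i) (hirr : ∀ i, ∃ y, f i y = h i ∧ ∀ j, j ≠ i → f j y < h j)
    (hJ : ∀ x ∈ polyhedron f h, ∀ i ∈ J, ∀ j ∈ J, f i x = h i → f j x = h j → i = j)
    {T : Finset (EuclideanSpace ℝ (Fin n))}
    (hT : polyhedron f h = ballHull (polyhedron f fun i => 2 * h i) (T : Set _)) :
    J.card ≤ T.card := by
  have hTP : ∀ t ∈ T, t ∈ polyhedron f h := fun t ht => hT ▸ subset_ballHull _ _ ht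
  have key : ∀ i, ∃ t ∈ T, f i t = h i := by
    intro i
    by_contra! hcon
    obtain ⟨y, hyi, hy⟩ := hirr i
    have hδ : ∃ δ : ℝ, 0 < δ ∧ ∀ t ∈ T, f i t + δ ≤ h i := by
      rcases T.eq_empty_or_nonempty with rfl | hTne
      · exact ⟨1, one_pos, by simp⟩
      · obtain ⟨t, ht, hmax⟩ := T.exists_max_image (f i) hTne
        refine ⟨h i - f i t, sub_pos.2 ((hTP t ht i).lt_of_ne (hcon t ht)), fun s hs => ?_⟩
        linarith [hmax s hs]
    obtain ⟨δ, hδ, hTδ⟩ := hδ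
    have hpos : 0 < h i - f i c := sub_pos.2 (hc i)
    obtain ⟨ε, ⟨hε₁, hε₂⟩, hε⟩ : ∃ ε : ℝ, ((∀ j, f j y < h j → f j (y + ε • (y - c)) < h j) ∧
        ε < δ / (h i - f i c)) ∧ 0 < ε :=
      ((((eventually_lt_of_lt y (y - c)).and (eventually_lt_nhds (div_pos hδ hpos))).filter_mono
        (nhdsWithin_le_nhds (s := Set.Ioi (0 : ℝ)))).and self_mem_nhdsWithin).exists
    rw [lt_div_iff₀ hpos] at hε₂
    have hval : f i (y + ε • (y - c)) = h i + ε * (h i - f i c) := by simp [hyi]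
    -- Pushing `y` slightly past facet `i` gives a translate whose bound `i` is just below `h i`: it
    -- still contains `T`, which stays `δ` away, but not `y`.
    have hsub : ballHull (polyhedron f fun i => 2 * h i) (T : Set _)
        ⊆ -(y + ε • (y - c)) +ᵥ polyhedron f fun i => 2 * h i := by
      refine ballHull_subset (isBallConvex_vadd _ _) fun t ht => mem_vadd_polyhedron.2 fun j => ?_
      rw [map_neg]
      by_cases hj : j = i
      · subst hj
        rw [hval]
        linarith [hTδ t ht]
      · linarith [hε₁ j (hy j hj), hTP t ht j]
    have hyP : y ∈ polyhedron f h := fun j => by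
      by_cases hj : j = i
      · exact hj ▸ hyi.le
      · exact (hy j hj).le
    have h1 := mem_vadd_polyhedron.1 (hsub (hT ▸ hyP)) i
    rw [map_neg, hval, hyi] at h1
    have := mul_pos hε hpos
    linarith
  choose g hgT hg using key
  exact Finset.card_le_card_of_injOn g (fun i _ => hgT i) fun i hi j hj hij =>
    hJ (g i) (hTP _ (hgT i)) i hi j hj (hg i) (hij ▸ hg j)

end BallHull

/-! ### The truncated simplex with `k + 1` pairwise disjoint cuts. -/

section TruncatedSimplex

variable {n k : ℕ}

/-- The functionals of a simplex truncated at `k + 1` vertices. -/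
noncomputable def truncatedSimplexFunctional (hkn : k ≤ n) :
    Fin n ⊕ Fin k ⊕ Bool → EuclideanSpace ℝ (Fin n) →L[ℝ] ℝ
  | .inl i => -EuclideanSpace.proj i
  | .inr (.inl i) => EuclideanSpace.proj (Fin.castLE hkn i)
  | .inr (.inr true) => ∑ i, EuclideanSpace.proj i
  | .inr (.inr false) => -∑ i, EuclideanSpace.proj i

/-- The right-hand sides of the inequalities `0 ≤ xᵢ`, `xᵢ ≤ 2` for `i < k`, `∑ xᵢ ≤ 3` and
`1 ≤ ∑ xᵢ`, which describe a simplex truncated at `k + 1` vertices. -/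
def truncatedSimplexBound : Fin n ⊕ Fin k ⊕ Bool → ℝ
  | .inl _ => 0
  | .inr (.inl _) => 2
  | .inr (.inr true) => 3
  | .inr (.inr false) => -1

theorem forall_truncatedSimplex {P : Fin n ⊕ Fin k ⊕ Bool → Prop} :
    (∀ i, P i) ↔ (∀ i, P (.inl i)) ∧ (∀ i, P (.inr (.inl i))) ∧ P (.inr (.inr true)) ∧
      P (.inr (.inr false)) := by
  simp only [Sum.forall, Bool.forall_bool]
  tauto

theorem exists_point_coord_sum (i : Fin n) (a b : ℝ) :
    ∃ x : EuclideanSpace ℝ (Fin n), x i = a ∧ (∀ j, j ≠ i → x j = b) ∧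
      ∑ j, x j = a + (n - 1) * b := by
  refine ⟨WithLp.toLp 2 fun j => b + if j = i then a - b else 0, by simp,
    fun j hj => by simp [hj], ?_⟩
  simp [Finset.sum_add_distrib]
  ring

theorem exists_point_const (hn : 3 ≤ n) (s : ℝ) :
    ∃ x : EuclideanSpace ℝ (Fin n), (∀ j, x j = s / n) ∧ ∑ j, x j = s := by
  have : (n : ℝ) ≠ 0 := by positivity
  refine ⟨WithLp.toLp 2 fun j => s / n, fun j => rfl, ?_⟩
  simp
  field_simp

theorem exists_truncatedSimplex_interior (hn : 3 ≤ n) (hkn : k ≤ n) :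
    ∃ c, ∀ i, truncatedSimplexFunctional hkn i c < truncatedSimplexBound i := by
  have hn' : (3 : ℝ) ≤ n := by exact_mod_cast hn
  obtain ⟨x, hx, hs⟩ := exists_point_const hn 2
  have h1 : ∀ j, 0 < x j := fun j => by
    rw [hx]
    positivity
  have h2 : ∀ j, x j < 2 := fun j => by
    rw [hx, div_lt_iff₀ (by positivity)]
    linarith
  refine ⟨x, forall_truncatedSimplex.2 ?_⟩
  simp only [truncatedSimplexFunctional, truncatedSimplexBound, neg_apply, sum_apply,
    PiLp.proj_apply, hs]
  exact ⟨fun j => neg_lt_zero.2 (h1 j), fun j => h2 _, by norm_num, by norm_num⟩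

theorem exists_truncatedSimplex_only_tight (hn : 3 ≤ n) (hkn : k ≤ n) (i : Fin n ⊕ Fin k ⊕ Bool) :
    ∃ y, truncatedSimplexFunctional hkn i y = truncatedSimplexBound i ∧
      ∀ j, j ≠ i → truncatedSimplexFunctional hkn j y < truncatedSimplexBound j := by
  have hn' : (3 : ℝ) ≤ n := by exact_mod_cast hn
  have hn1 : (0 : ℝ) < n - 1 := by linarith
  rcases i with i | i | b
  · obtain ⟨y, hyi, hy, hs⟩ := exists_point_coord_sum i 0 (2 / (n - 1))
    rw [mul_div_cancel₀ _ hn1.ne'] at hs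
    have h1 : (0 : ℝ) < 2 / (n - 1) := by positivity
    have h2 : (2 : ℝ) / (n - 1) < 2 := (div_lt_iff₀ hn1).2 (by linarith)
    refine ⟨y, by simp [truncatedSimplexFunctional, truncatedSimplexBound, hyi],
      forall_truncatedSimplex.2 ?_⟩
    simp only [truncatedSimplexFunctional, truncatedSimplexBound, neg_apply,
      sum_apply, PiLp.proj_apply, hs]
    refine ⟨fun j hj => ?_, fun j _ => ?_, fun _ => by linarith, fun _ => by linarith⟩
    · rw [hy j (fun h => hj (congrArg _ h))]
      linarith
    · by_cases hj : Fin.castLE hkn j = i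
      · rw [hj, hyi]
        norm_num
      · rw [hy _ hj]
        exact h2
  · obtain ⟨y, hyi, hy, hs⟩ := exists_point_coord_sum (Fin.castLE hkn i) 2 ((1 / 2) / (n - 1))
    rw [mul_div_cancel₀ _ hn1.ne'] at hs
    have h1 : (0 : ℝ) < (1 / 2) / (n - 1) := by positivity
    have h2 : (1 / 2 : ℝ) / (n - 1) < 2 := (div_lt_iff₀ hn1).2 (by linarith)
    refine ⟨y, by simp [truncatedSimplexFunctional, truncatedSimplexBound, hyi],
      forall_truncatedSimplex.2 ?_⟩
    simp only [truncatedSimplexFunctional, truncatedSimplexBound, neg_apply,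
      sum_apply, PiLp.proj_apply, hs]
    refine ⟨fun j _ => ?_, fun j hj => ?_, fun _ => by linarith, fun _ => by linarith⟩
    · by_cases hj : j = Fin.castLE hkn i
      · rw [hj, hyi]
        norm_num
      · rw [hy _ hj]
        linarith
    · rw [hy _ (fun h => hj (by rw [Fin.castLE_injective hkn h]))]
      exact h2
  · have key : ∀ s : ℝ, 1 ≤ s → s ≤ 3 → 0 < s / n ∧ s / n < 2 := fun s h1 h3 =>
      ⟨by positivity, (div_lt_iff₀ (by positivity)).2 (by linarith)⟩
    cases b
    · obtain ⟨y, hy, hs⟩ := exists_point_const hn 1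
      have h := fun j => hy j ▸ key 1 le_rfl (by norm_num)
      refine ⟨y, by simp [truncatedSimplexFunctional, truncatedSimplexBound, hs],
        forall_truncatedSimplex.2 ?_⟩
      simp only [truncatedSimplexFunctional, truncatedSimplexBound, neg_apply,
        sum_apply, PiLp.proj_apply, hs]
      exact ⟨fun j _ => neg_lt_zero.2 (h j).1, fun _ _ => (h _).2, fun _ => by norm_num,
        fun h => absurd rfl h⟩
    · obtain ⟨y, hy, hs⟩ := exists_point_const hn 3
      have h := fun j => hy j ▸ key 3 (by norm_num) le_rfl
      refine ⟨y, by simp [truncatedSimplexFunctional, truncatedSimplexBound, hs],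
        forall_truncatedSimplex.2 ?_⟩
      simp only [truncatedSimplexFunctional, truncatedSimplexBound, neg_apply,
        sum_apply, PiLp.proj_apply, hs]
      exact ⟨fun j _ => neg_lt_zero.2 (h j).1, fun _ _ => (h _).2, fun h => absurd rfl h,
        fun _ => by norm_num⟩

theorem isCompact_truncatedSimplex (hkn : k ≤ n) :
    IsCompact
      (polyhedron (truncatedSimplexFunctional hkn) fun i => 2 * truncatedSimplexBound i) := by
  refine Metric.isCompact_of_isClosed_isBounded isClosed_polyhedron ?_
  refine isBounded_iff_forall_norm_le.2 ⟨√(∑ _i : Fin n, 6 ^ 2), fun x hx => ?_⟩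
  rw [mem_polyhedron, forall_truncatedSimplex] at hx
  simp only [truncatedSimplexFunctional, truncatedSimplexBound, neg_apply,
    sum_apply, PiLp.proj_apply] at hx
  obtain ⟨h1, -, h2, -⟩ := hx
  have h0 : ∀ i, 0 ≤ x i := fun i => by linarith [h1 i]
  rw [EuclideanSpace.norm_eq]
  refine Real.sqrt_le_sqrt (Finset.sum_le_sum fun i _ => ?_)
  rw [Real.norm_of_nonneg (h0 i)]
  have := Finset.single_le_sum (fun j _ => h0 j) (Finset.mem_univ i)
  exact pow_le_pow_left₀ (h0 i) (by linarith) 2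

/-- Two coordinates equal to 2 would give a sum of at least 4, above 3; one coordinate equal to 2
already exceeds a sum of 1. The excluded index is the original simplex facet `∑ xᵢ = 3`. -/
theorem truncatedSimplex_tight_unique (hkn : k ≤ n) {x : EuclideanSpace ℝ (Fin n)}
    (hx : x ∈ polyhedron (truncatedSimplexFunctional hkn) truncatedSimplexBound)
    {i j : Fin k ⊕ Bool} (hi : i ≠ .inr true) (hj : j ≠ .inr true)
    (hxi : truncatedSimplexFunctional hkn (.inr i) x = truncatedSimplexBound (.inr i : Fin n ⊕ _))
    (hxj : truncatedSimplexFunctional hkn (.inr j) x = truncatedSimplexBound (.inr j : Fin n ⊕ _)) :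
    i = j := by
  rw [mem_polyhedron, forall_truncatedSimplex] at hx
  simp only [truncatedSimplexFunctional, truncatedSimplexBound, neg_apply,
    sum_apply, PiLp.proj_apply] at hx
  obtain ⟨h1, -, h2, -⟩ := hx
  have h0 : ∀ i, 0 ≤ x i := fun i => by linarith [h1 i]
  have hle : ∀ i, x i ≤ ∑ j, x j := fun i =>
    Finset.single_le_sum (fun j _ => h0 j) (Finset.mem_univ i)
  rcases i with i | _ | _ <;> rcases j with j | _ | _ <;>
    simp only [truncatedSimplexFunctional, truncatedSimplexBound, neg_apply,
      sum_apply, PiLp.proj_apply, ne_eq, not_true_eq_false] at hxi hxj hi hj ⊢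
  · by_contra hne
    have hne' : Fin.castLE hkn i ≠ Fin.castLE hkn j := fun h =>
      hne (by rw [Fin.castLE_injective hkn h])
    have := Finset.sum_le_univ_sum_of_nonneg (s := {Fin.castLE hkn i, Fin.castLE hkn j}) h0
    rw [Finset.sum_pair hne'] at this
    linarith
  · linarith [hle (Fin.castLE hkn i)]
  · linarith [hle (Fin.castLE hkn j)]

theorem exists_polytope_not_generated (hn : 3 ≤ n) (hkn : k ≤ n) :
    ∃ C : Set (EuclideanSpace ℝ (Fin n)), IsFullPolytope C ∧
      (facets C).encard = ((n + k + 2 : ℕ) : ℕ∞) ∧ ¬ EveryBallConvexGenerated C k := by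
  classical
  obtain ⟨c, hc⟩ := exists_truncatedSimplex_interior hn hkn
  have hirr := exists_truncatedSimplex_only_tight hn hkn
  have hc2 : ∀ i, truncatedSimplexFunctional hkn i ((2 : ℝ) • c)
      < 2 * truncatedSimplexBound (n := n) i := by
    intro i
    rw [map_smul, smul_eq_mul]
    linarith [hc i]
  refine ⟨polyhedron (truncatedSimplexFunctional hkn) fun i => 2 * truncatedSimplexBound i,
    ⟨exists_finite_polyhedron_eq_convexHull (isCompact_truncatedSimplex hkn),
      (2 : ℝ) • c, ?_⟩, ?_, fun hgen => ?_⟩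
  · rw [mem_interior_iff_mem_nhds]
    refine Filter.mem_of_superset (Filter.eventually_all.2 fun i =>
      ((truncatedSimplexFunctional hkn i).continuous.tendsto _).eventually_lt_const (hc2 i)) ?_
    exact fun x hx i => (hx i).le
  · rw [encard_facets_polyhedron hc2]
    · simp
      norm_cast
    · intro i
      obtain ⟨y, hyi, hy⟩ := hirr i
      refine ⟨(2 : ℝ) • y, by simp [hyi], fun j hj => ?_⟩
      rw [map_smul, smul_eq_mul]
      linarith [hy j hj]
  · obtain ⟨T, hTk, hT⟩ := hgen _ (isBallConvex_polyhedron_two_mul hirr)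
    -- The chosen constraints are the `k` cuts `xᵢ = 2` and the cut `∑ xᵢ = 1`, which force `k + 1`
    -- points.
    have hJ := card_le_of_eq_ballHull
      (Finset.univ.erase (.inr true : Fin k ⊕ Bool) |>.map (Function.Embedding.inr (α := Fin n)))
      hc hirr (fun x hx i hi j hj hxi hxj => by
        obtain ⟨i, hi', rfl⟩ := Finset.mem_map.1 hi
        obtain ⟨j, hj', rfl⟩ := Finset.mem_map.1 hj
        exact congrArg _ (truncatedSimplex_tight_unique hkn hx (Finset.mem_erase.1 hi').1
          (Finset.mem_erase.1 hj').1 hxi hxj)) hT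
    rw [Finset.card_map, Finset.card_erase_of_mem (Finset.mem_univ _), Finset.card_univ,
      Fintype.card_sum, Fintype.card_fin, Fintype.card_bool] at hJ
    omega

end TruncatedSimplex

end BallConvexity

theorem mainTheorem2 (n : ℕ) (hn : 3 ≤ n) :
    (∀ k : ℕ, 2 ≤ k → k ≤ n →
      ∃ C : Set (EuclideanSpace ℝ (Fin n)), BallConvexity.IsFullPolytope C ∧
        (BallConvexity.facets C).encard = ((n + k + 2 : ℕ) : ℕ∞) ∧
        ¬ BallConvexity.EveryBallConvexGenerated C k) ∧
    (∀ k : ℕ, 2 ≤ k →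
      ∀ C : Set (EuclideanSpace ℝ (Fin n)), BallConvexity.IsFullPolytope C →
        (BallConvexity.facets C).encard ≤ ((n + k + 1 : ℕ) : ℕ∞) →
        BallConvexity.EveryBallConvexGenerated C k) :=
  ⟨fun _ _ hkn => BallConvexity.exists_polytope_not_generated hn hkn,
    fun _ hk _ => BallConvexity.everyBallConvexGenerated_of_encard_facets_le hn hk⟩
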